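/- Let $\Bbbk$ be $\mathbb{Z}$ or a prime field ($\mathbb{Q}$ or $\mathbb{F}_p$), and let $\mathbf{gr}$ be the category of free groups of finite rank $\mathbb{Z}^{*n}$ ($n\in\mathbb{N}$) and all group homomorphisms. For functors $X:\mathbf{gr}^{op}\to\Bbbk\text{-}\mathbf{Mod}$ and $F:\mathbf{gr}\to\Bbbk\text{-}\mathbf{Mod}$, let $X\otimes_{\mathbf{gr}}F$ be the tensor product over $\mathbf{gr}$ (the coend of $(A,B)\mapsto X(A)\otimes_{\Bbbk}F(B)$), and let $\mathrm{Tor}^{\mathbf{gr}}_i(X,-)$ ($i\geq 0$) be the left derived functors of $X\otimes_{\mathbf{gr}}-$ on the functor category $\mathbf{Fct}(\mathbf{gr},\Bbbk\text{-}\mathbf{Mod})$. The tensor product of two functors on $\mathbf{gr}$ is taken pointwise: $(F\otimes G)(A)=F(A)\otimes_{\Bbbk}G(A)$. Let $\mathfrak{a}:\mathbf{gr}\to\Bbbk\text{-}\mathbf{Mod}$ be $A\mapsto \Bbbk\otimes_{\mathbb{Z}}A_{ab}$ and let $P_n:=\Bbbk[\mathbf{gr}(\mathbb{Z}^{*n},-)]$.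 A functor $F:\mathbf{gr}\to\Bbbk\text{-}\mathbf{Mod}$ is reduced if it vanishes on the trivial group. It is polynomial if there is $d\in\mathbb{N}$ such that its $(d+1)$-st cross-effect vanishes, i.e. for all $A_1,\dots,A_{d+1}$ in $\mathbf{gr}$ the kernels of the $d+1$ maps $F(A_1*\dots*A_{d+1})\to F(A_1*\dots*\widehat{A_i}*\dots*A_{d+1})$, induced by killing the $i$-th factor, have zero intersection. Proposition. Let $X:\mathbf{gr}^{op}\to\Bbbk\text{-}\mathbf{Mod}$ be a functor such that $\mathrm{Tor}^{\mathbf{gr}}_i(X,\mathfrak{a}\otimes P_n)=0$ for all $i,n\in\mathbb{N}$. Then $\mathrm{Tor}^{\mathbf{gr}}_i(X,F\otimes G)=0$ for every $i\in\mathbb{N}$, every reduced polynomial functor $F:\mathbf{gr}\to\Bbbk\text{-}\mathbf{Mod}$ and every functor $G:\mathbf{gr}\to\Bbbk\text{-}\mathbf{Mod}$. -/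

import Mathlib

open CategoryTheory CategoryTheory.Limits MonoidalCategory Opposite
open scoped TensorProduct ZeroObject

universe v u

namespace FunctorHomology

section Polynomial

/-! ### Reduced and polynomial functors -/

variable {C : Type u} [Category.{v} C] [HasZeroMorphisms C] [HasFiniteCoproducts C]
variable {k : Type u} [CommRing k]

/-- The projection `c₁ + ⋯ + cₙ ⟶ c₁ + ⋯ + ĉᵢ + ⋯ + cₙ` which kills the `i`-th summand of a
coproduct in a pointed category: it is zero on `cᵢ` and the inclusion on `cⱼ` for `j ≠ i`. -/
noncomputable def collapse {n : ℕ} (c : Fin n → C) (i : Fin n) :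
    (∐ c) ⟶ ∐ (fun j : {j : Fin n // j ≠ i} => c j) :=
  Sigma.desc fun j =>
    if h : j = i then 0 else Sigma.ι (fun j : {j : Fin n // j ≠ i} => c j) ⟨j, h⟩

/-- The value `cr_n(F)(c₁, …, cₙ)` of the `n`-th cross-effect of `F`: the common kernel of the
maps `F(c₁ + ⋯ + cₙ) → F(c₁ + ⋯ + ĉᵢ + ⋯ + cₙ)`. -/
noncomputable def crossEffect (F : C ⥤ ModuleCat.{u} k) (n : ℕ) (c : Fin n → C) :
    Submodule k (F.obj (∐ c)) :=
  ⨅ i : Fin n, LinearMap.ker (F.map (collapse c i)).hom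

/-- `F` is polynomial of degree at most `d`: its `(d + 1)`-st cross-effect vanishes. -/
def IsPolynomialOfDegreeLE (F : C ⥤ ModuleCat.{u} k) (d : ℕ) : Prop :=
  ∀ c : Fin (d + 1) → C, crossEffect F (d + 1) c = ⊥

/-- `F` is polynomial, i.e. polynomial of degree at most `d` for some `d`. -/
def IsPolynomial (F : C ⥤ ModuleCat.{u} k) : Prop :=
  ∃ d : ℕ, IsPolynomialOfDegreeLE F d

/-- `F` is reduced: it vanishes on the zero object. -/
def IsReduced [HasZeroObject C] (F : C ⥤ ModuleCat.{u} k) : Prop :=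
  IsZero (F.obj (0 : C))

end Polynomial

section Tor

/-! ### Tensor product over a small category and its derived functors -/
variable (k : Type u) [CommRing k] {C : Type u} [SmallCategory C]

/-- The standard projective functor `P_c = k[C(c, -)]`. -/
noncomputable abbrev stdProj (c : C) : C ⥤ ModuleCat.{u} k :=
  coyoneda.obj (op c) ⋙ ModuleCat.free k

variable {k}

/-- The natural transformation `P_c ⟶ F` attached to `x ∈ F(c)` by the Yoneda lemma. -/
noncomputable def stdProjDesc {c : C} {F : C ⥤ ModuleCat.{u} k} (x : F.obj c) :
    stdProj k c ⟶ F where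
  app d := ModuleCat.freeDesc (TypeCat.ofHom fun f : c ⟶ d => F.map f x)
  naturality d e g := by
    refine ModuleCat.free_hom_ext fun (f : c ⟶ d) => ?_
    simp

theorem stdProjDesc_freeMk {c d : C} {F : C ⥤ ModuleCat.{u} k} (x : F.obj c) (f : c ⟶ d) :
    (stdProjDesc x).app d (ModuleCat.freeMk f) = F.map f x :=
  ModuleCat.freeDesc_apply _ _

theorem stdProj_hom_ext {c : C} {F : C ⥤ ModuleCat.{u} k} {f g : stdProj k c ⟶ F}
    (h : f.app c (ModuleCat.freeMk (𝟙 c)) = g.app c (ModuleCat.freeMk (𝟙 c))) : f = g := by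
  ext d : 2
  refine ModuleCat.free_hom_ext fun (a : c ⟶ d) => ?_
  have e : (ModuleCat.freeMk a : (stdProj k c).obj d) =
      (stdProj k c).map a (ModuleCat.freeMk (𝟙 c)) := by simp
  change f.app d (ModuleCat.freeMk a) = g.app d (ModuleCat.freeMk a)
  rw [e, NatTrans.naturality_apply, NatTrans.naturality_apply, h]

instance projective_stdProj (c : C) : Projective (stdProj k c) where
  factors {E X} f e _ := by
    have he : Epi (e.app c) := inferInstance
    obtain ⟨y, hy⟩ := (ModuleCat.epi_iff_surjective _).1 he (f.app c (ModuleCat.freeMk (𝟙 c)))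
    refine ⟨stdProjDesc y, stdProj_hom_ext ?_⟩
    change e.app c ((stdProjDesc y).app c (ModuleCat.freeMk (𝟙 c))) = _
    rw [stdProjDesc_freeMk, CategoryTheory.Functor.map_id, ModuleCat.id_apply]
    exact hy

/-- Every functor is a quotient of a direct sum of functors `P_c`. -/
instance enoughProjectives_functor : EnoughProjectives (C ⥤ ModuleCat.{u} k) where
  presentation F := ⟨{
    p := ∐ fun p : Σ c : C, F.obj c => stdProj k p.1
    f := Sigma.desc fun p => stdProjDesc p.2
    epi := by
      rw [NatTrans.epi_iff_epi_app]
      intro c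
      rw [ModuleCat.epi_iff_surjective]
      intro x
      refine ⟨(Sigma.ι (fun p : Σ c : C, F.obj c => stdProj k p.1) ⟨c, x⟩).app c
        (ModuleCat.freeMk (𝟙 c)), ?_⟩
      have h := congrArg (fun t => t.app c (ModuleCat.freeMk (𝟙 c)))
        (Sigma.ι_desc (fun p : Σ c : C, F.obj c => stdProjDesc (k := k) p.2) ⟨c, x⟩)
      refine h.trans ((stdProjDesc_freeMk x (𝟙 c)).trans ?_)
      rw [CategoryTheory.Functor.map_id, ModuleCat.id_apply] }⟩

/-- The functor sending `F` to the bifunctor `(c, d) ↦ X(c) ⊗ F(d)`. -/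
noncomputable def externalTensor (X : Cᵒᵖ ⥤ ModuleCat.{u} k) :
    (C ⥤ ModuleCat.{u} k) ⥤ (Cᵒᵖ ⥤ C ⥤ ModuleCat.{u} k) where
  obj F := X ⋙ curriedTensor (ModuleCat.{u} k) ⋙ (Functor.whiskeringLeft C _ _).obj F
  map η := Functor.whiskerLeft X (Functor.whiskerLeft (curriedTensor (ModuleCat.{u} k))
    ((Functor.whiskeringLeft C _ _).map η))

/-- The tensor product over `C`, as a functor of the covariant variable: `X ⊗_C F` is the
coend of `(c, d) ↦ X(c) ⊗ F(d)`. -/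
noncomputable def tensorOver (X : Cᵒᵖ ⥤ ModuleCat.{u} k) :
    (C ⥤ ModuleCat.{u} k) ⥤ ModuleCat.{u} k :=
  externalTensor X ⋙ coendFunctor C (ModuleCat.{u} k)

instance tensorOver_additive (X : Cᵒᵖ ⥤ ModuleCat.{u} k) : (tensorOver X).Additive where
  map_add {F G f g} := by
    change coend.map ((externalTensor X).map (f + g)) =
      coend.map ((externalTensor X).map f) + coend.map ((externalTensor X).map g)
    apply coend.hom_ext
    intro j
    rw [Preadditive.comp_add, coend.ι_map, coend.ι_map, coend.ι_map, ← Preadditive.add_comp]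
    congr 1
    change X.obj (op j) ◁ (f.app j + g.app j) = X.obj (op j) ◁ f.app j + X.obj (op j) ◁ g.app j
    exact MonoidalPreadditive.whiskerLeft_add _ _

/-- `Tor^C_i(X, F)`, as a functor of `F`: the `i`-th left derived functor of `X ⊗_C -`. -/
noncomputable def functorTor (X : Cᵒᵖ ⥤ ModuleCat.{u} k) (i : ℕ) :
    (C ⥤ ModuleCat.{u} k) ⥤ ModuleCat.{u} k :=
  (tensorOver X).leftDerived i

end Tor

section FreeGroups

/-! ### The category of free groups of finite rank -/

/-- The category `gr` of free groups of finite rank, with one object `ℤ^{*n}` (the free group on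
`n` generators) for each `n ∈ ℕ`. -/
structure Gr : Type where
  /-- The number `n` of free factors of `ℤ^{*n}`. -/
  rank : ℕ

namespace Gr

/-- The underlying group `ℤ^{*n}`. -/
abbrev toGroup (X : Gr) : Type := FreeGroup (Fin X.rank)

/-- The morphisms of `gr` are all group homomorphisms. -/
instance : SmallCategory Gr where
  Hom X Y := X.toGroup →* Y.toGroup
  id X := MonoidHom.id X.toGroup
  comp f g := MonoidHom.comp g f

/-- The group homomorphism underlying a morphism of `gr`. -/
abbrev hom {X Y : Gr} (f : X ⟶ Y) : X.toGroup →* Y.toGroup := f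

/-- The morphism of `gr` given by a group homomorphism. -/
abbrev ofHom {X Y : Gr} (f : X.toGroup →* Y.toGroup) : X ⟶ Y := f

theorem hom_ext {X Y : Gr} {f g : X ⟶ Y}
    (h : ∀ i : Fin X.rank, hom f (FreeGroup.of i) = hom g (FreeGroup.of i)) : f = g :=
  FreeGroup.ext_hom _ _ h

/-- The inclusion of `gr` into the category of groups. -/
def toGrpCat : Gr ⥤ GrpCat.{0} where
  obj X := GrpCat.of X.toGroup
  map f := GrpCat.ofHom (hom f)

instance : HasZeroMorphisms Gr where
  zero _ _ := ⟨ofHom 1⟩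
  comp_zero _ _ := rfl
  zero_comp _ _ _ f := MonoidHom.comp_one (hom f)

/-- The trivial group is a zero object of `gr`. -/
theorem isZero_mk_zero : IsZero (mk 0) := by
  rw [IsZero.iff_id_eq_zero]
  exact hom_ext fun i => i.elim0

instance : HasZeroObject Gr := ⟨mk 0, isZero_mk_zero⟩

/-- The free product `ℤ^{*m} * ℤ^{*n} = ℤ^{*(m + n)}`. -/
def binaryCofan (X Y : Gr) : BinaryCofan X Y :=
  BinaryCofan.mk (P := mk (X.rank + Y.rank)) (ofHom (FreeGroup.map (Fin.castAdd Y.rank)))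
    (ofHom (FreeGroup.map (Fin.natAdd X.rank)))

/-- `ℤ^{*m} * ℤ^{*n} = ℤ^{*(m + n)}` is a coproduct in `gr`. -/
def isColimitBinaryCofan (X Y : Gr) : IsColimit (binaryCofan X Y) :=
  BinaryCofan.IsColimit.mk _
    (fun {T} f g => ofHom (X := mk (X.rank + Y.rank)) (FreeGroup.lift (Fin.addCases
      (fun i => hom f (FreeGroup.of i)) (fun i => hom g (FreeGroup.of i)))))
    (fun {T} f g => hom_ext (X := X) fun i => by
      change FreeGroup.lift _ (FreeGroup.map _ (FreeGroup.of i)) = _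
      rw [FreeGroup.map.of, FreeGroup.lift_apply_of, Fin.addCases_left])
    (fun {T} f g => hom_ext (X := Y) fun i => by
      change FreeGroup.lift _ (FreeGroup.map _ (FreeGroup.of i)) = _
      rw [FreeGroup.map.of, FreeGroup.lift_apply_of, Fin.addCases_right])
    (fun {T} f g h hf hg => hom_ext (X := mk (X.rank + Y.rank)) fun i => by
      subst hf hg
      refine Fin.addCases (fun i => ?_) (fun i => ?_) i
      · refine Eq.trans ?_ (FreeGroup.lift_apply_of (β := T.toGroup)).symm
        rw [Fin.addCases_left]
        exact congrArg (hom h) FreeGroup.map.of.symm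
      · refine Eq.trans ?_ (FreeGroup.lift_apply_of (β := T.toGroup)).symm
        rw [Fin.addCases_right]
        exact congrArg (hom h) FreeGroup.map.of.symm)

instance : HasFiniteCoproducts Gr :=
  have (X Y : Gr) : HasColimit (pair X Y) := ⟨⟨⟨_, isColimitBinaryCofan X Y⟩⟩⟩
  have : HasBinaryCoproducts Gr := hasBinaryCoproducts_of_hasColimit_pair _
  have : HasInitial Gr := isZero_mk_zero.isInitial.hasInitial
  hasFiniteCoproducts_of_has_binary_and_initial

/-- The property of being a finitely generated free group. -/
def IsFGFree : ObjectProperty GrpCat.{0} :=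
  fun G => IsFreeGroup G ∧ Group.FG G

/-- The functor from `gr` to the full subcategory of all finitely generated free groups. -/
def toFGFree : Gr ⥤ IsFGFree.FullSubcategory :=
  ObjectProperty.lift _ toGrpCat fun X =>
    ⟨inferInstanceAs (IsFreeGroup X.toGroup), inferInstanceAs (Group.FG X.toGroup)⟩

theorem finite_of_fg_freeGroup (S : Type) [Group.FG (FreeGroup S)] : Finite S := by
  have h1 : Group.FG (Abelianization (FreeGroup S)) :=
    Group.fg_of_surjective (f := Abelianization.of) (QuotientGroup.mk_surjective)
  have h2 : AddGroup.FG (FreeAbelianGroup S) :=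
    inferInstanceAs (AddGroup.FG (Additive (Abelianization (FreeGroup S))))
  have h3 : Module.Finite ℤ (FreeAbelianGroup S) := Module.Finite.iff_addGroup_fg.mpr h2
  exact Module.Finite.finite_basis (FreeAbelianGroup.basis S)

/-- `gr` is equivalent to the full subcategory of all finitely generated free groups. -/
instance : toFGFree.IsEquivalence where
  faithful := ⟨fun {X Y f g} h => congrArg (fun t => t.hom.hom) h⟩
  full := ⟨fun {X Y} f => ⟨ofHom f.hom.hom, rfl⟩⟩
  essSurj := ⟨fun G => by
    obtain ⟨h1, h2⟩ := G.property
    have e := IsFreeGroup.toFreeGroup G.obj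
    have : Group.FG (FreeGroup (IsFreeGroup.Generators G.obj)) :=
      Group.fg_of_surjective (f := e.toMonoidHom) e.surjective
    have := finite_of_fg_freeGroup (IsFreeGroup.Generators G.obj)
    obtain ⟨n, ⟨f⟩⟩ := Finite.exists_equiv_fin (IsFreeGroup.Generators G.obj)
    exact ⟨mk n, ⟨ObjectProperty.isoMk _
      ((FreeGroup.freeGroupCongr f).symm.trans e.symm).toGrpIso⟩⟩⟩

end Gr

/-- The `ℤ`-linear map `G_ab → H_ab` induced by a group homomorphism `G → H`. -/
def abMap {G H : Type} [Group G] [Group H] (f : G →* H) :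
    Additive (Abelianization G) →ₗ[ℤ] Additive (Abelianization H) :=
  (MonoidHom.toAdditive (Abelianization.map f)).toIntLinearMap

theorem abMap_id (G : Type) [Group G] : abMap (MonoidHom.id G) = LinearMap.id := by
  rw [abMap, Abelianization.map_id]
  rfl

theorem abMap_comp {G H K : Type} [Group G] [Group H] [Group K] (g : H →* K) (f : G →* H) :
    abMap (g.comp f) = abMap g ∘ₗ abMap f := by
  rw [abMap, ← Abelianization.map_comp]
  rfl

/-- The abelianization functor tensored with `k`: `𝔞(G) = k ⊗_ℤ G_ab`. -/
noncomputable def abelianization (k : Type) [CommRing k] : Gr ⥤ ModuleCat.{0} k where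
  obj X := ModuleCat.of k (k ⊗[ℤ] Additive (Abelianization X.toGroup))
  map f := ModuleCat.ofHom ((abMap (Gr.hom f)).baseChange k)
  map_id X := (congrArg (fun t => ModuleCat.ofHom (LinearMap.baseChange k t))
    (abMap_id X.toGroup)).trans (congrArg ModuleCat.ofHom LinearMap.baseChange_id)
  map_comp f g := (congrArg (fun t => ModuleCat.ofHom (LinearMap.baseChange k t))
    (abMap_comp (Gr.hom g) (Gr.hom f))).trans
      (congrArg ModuleCat.ofHom (LinearMap.baseChange_comp _ _))

/-- The functor `P_n = k[gr(ℤ^{*n}, -)]`. -/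
noncomputable def P (k : Type) [CommRing k] (n : ℕ) : Gr ⥤ ModuleCat.{0} k :=
  stdProj k (Gr.mk n)

end FreeGroups

/-- `k` is (isomorphic to) the ring of integers or a prime field `ℚ` or `𝔽_p`. -/
def IsIntegersOrPrimeField (k : Type) [CommRing k] : Prop :=
  Nonempty (k ≃+* ℤ) ∨ Nonempty (k ≃+* ℚ) ∨ ∃ p : ℕ, p.Prime ∧ Nonempty (k ≃+* ZMod p)

end FunctorHomology

/-! Since `X ⊗ -` is left adjoint to `M ↦ Hom_k(X, M)`, the vanishing of `Tor_i(X, Y)` amounts to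
that of `Ext^i(Y, N)` for all `N = Hom_k(X, I)` with `I` injective (`isZero_leftDerived_obj_iff`).
Fix such an `N`. As `𝔞` has free values, `𝔞 ⊗ -` is exact; covering `G` by a sum of functors `P_n`
and shifting degrees gives `Ext(𝔞 ⊗ G, N) = 0` for every `G` (`subsingleton_ext_tensor`).

Now `F ⊗ G` is the diagonal of the bifunctor `B(X, Y) = F(X) ⊗ G(Y)`, which is reduced and
polynomial in `X` alone. For any such `B`, consider the fold map from `cr₂(B(-, Y))(X, X)` to `B(X,
Y)` (`crossFold`). Its cokernel `Q` is additive in `X`, so `Q(X, Y) ≅ 𝔞(X) ⊗ Q(ℤ, Y)` and its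
diagonal has the form `𝔞 ⊗ G'`. Its source agrees on the diagonal with `cr₂(B(-, Y))(X, Y)`, which
is reduced in `X` with the degree bound lowered by one: one argument has been absorbed into the
unrestricted variable `Y`. Its kernel keeps the degree bound of `B`, but matters only in smaller
`Ext` degrees. Induction on the polynomial degree, and inside it on the `Ext` degree, concludes
(`subsingleton_ext_diag_of_degreeLeftLE`). -/

namespace FunctorHomology

/-! ### Vanishing of `Ext` in an abelian category, and its relation to left derived functors. -/

section ExtVanishing

universe w v₁ u₁ v₂ u₂

open Abelian

variable {A : Type u₁} [Category.{v₁} A] [Abelian A]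

/-- A short complex is exact if every morphism to an injective object which vanishes on the
left extends from the middle to the right. -/
theorem exact_of_extend_injective [EnoughInjectives A] (S : ShortComplex A)
    (h : ∀ (I : A) [Injective I] (f : S.X₂ ⟶ I), S.f ≫ f = 0 → ∃ g : S.X₃ ⟶ I, S.g ≫ g = f) :
    S.Exact := by
  rw [S.exact_iff_kernel_ι_comp_cokernel_π_zero]
  -- The universal test: if the projection to the cokernel, embedded in an injective, factors
  -- through `S.g`, then it kills the kernel of `S.g`.
  obtain ⟨g, hg⟩ := h (Injective.under (cokernel S.f)) (cokernel.π S.f ≫ Injective.ι _) (by simp)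
  rw [← cancel_mono (Injective.ι (cokernel S.f)), Category.assoc, ← hg, kernel.condition_assoc,
    zero_comp, zero_comp]

section Adjunction

variable {B : Type u₂} [Category.{v₂} B] [Abelian B] [HasProjectiveResolutions A]

theorem isZero_leftDerived_obj_iff_exact (L : A ⥤ B) [L.Additive] {Y : A}
    (P : ProjectiveResolution Y) (n : ℕ) :
    IsZero ((L.leftDerived (n + 1)).obj Y) ↔
      (ShortComplex.mk (L.map (P.complex.d (n + 2) (n + 1))) (L.map (P.complex.d (n + 1) n))
        (by rw [← L.map_comp, P.complex.d_comp_d, L.map_zero])).Exact := by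
  rw [(P.isoLeftDerivedObj L (n + 1)).isZero_iff]
  change IsZero (((L.mapHomologicalComplex _).obj P.complex).homology (n + 1)) ↔ _
  rw [← HomologicalComplex.exactAt_iff_isZero_homology,
    HomologicalComplex.exactAt_iff' _ (n + 2) (n + 1) n (by simp) (by simp)]
  rfl

/-- Left derived functors of a left adjoint vanish exactly when the `Ext` groups into the images
of injective objects under the right adjoint do. -/
theorem isZero_leftDerived_obj_iff [HasExt.{w} A] [EnoughInjectives B] {L : A ⥤ B} [L.Additive]
    {R : B ⥤ A} (adj : L ⊣ R) (Y : A) (n : ℕ) :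
    IsZero ((L.leftDerived n).obj Y) ↔
      ∀ (I : B) [Injective I], Subsingleton (Ext.{w} Y (R.obj I) n) := by
  cases n with
  | zero =>
    have := adj.leftAdjoint_preservesColimits
    rw [(L.leftDerivedZeroIsoSelf.app Y).isZero_iff]
    constructor
    · intro h I _
      have : Subsingleton (L.obj Y ⟶ I) := ⟨fun f g => h.eq_of_src f g⟩
      have : Subsingleton (Y ⟶ R.obj I) := (adj.homEquiv Y I).symm.injective.subsingleton
      exact Ext.addEquiv₀.toEquiv.injective.subsingleton
    · intro h
      -- Test on an injective object containing `L Y`: the embedding is adjoint to a zero morphism,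
      -- so `L Y = 0`.
      have h1 : Subsingleton (Y ⟶ R.obj (Injective.under (L.obj Y))) :=
        have := h (Injective.under (L.obj Y))
        Ext.addEquiv₀.symm.toEquiv.injective.subsingleton
      have h2 : Injective.ι (L.obj Y) = 0 :=
        (adj.homEquiv Y _).injective (Subsingleton.elim _ _)
      exact IsZero.of_mono_eq_zero _ h2
  | succ n =>
    obtain ⟨P⟩ := (inferInstance : HasProjectiveResolution Y).out
    rw [isZero_leftDerived_obj_iff_exact L P]
    constructor
    · intro h I _
      refine subsingleton_of_forall_eq 0 fun e => ?_
      -- A class is a cocycle on the resolution. Its transpose kills boundaries of `L P`, so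
      -- exactness and injectivity of `I` extend it along the differential; transposing back
      -- exhibits a coboundary.
      obtain ⟨f, hf, rfl⟩ := P.extMk_surjective e (n + 2) rfl
      rw [P.extMk_eq_zero_iff _ _ _ _ n rfl]
      have hf' : L.map (P.complex.d (n + 2) (n + 1)) ≫ (adj.homEquiv _ _).symm f = 0 := by
        rw [← adj.homEquiv_naturality_left_symm, hf]
        simp [Adjunction.homEquiv_counit]
      refine ⟨adj.homEquiv _ _ (h.descToInjective _ hf'), ?_⟩
      rw [← adj.homEquiv_naturality_left]
      exact (adj.homEquiv _ _).symm_apply_eq.1 (h.comp_descToInjective _ hf').symm |>.symm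
    · intro h
      refine exact_of_extend_injective _ fun I _ f hf => ?_
      change L.map _ ≫ f = 0 at hf
      have hf' : P.complex.d (n + 2) (n + 1) ≫ adj.homEquiv _ _ f = 0 := by
        rw [← adj.homEquiv_naturality_left, hf, ← Equiv.eq_symm_apply]
        simp [Adjunction.homEquiv_counit]
      have := h I
      obtain ⟨g, hg⟩ := (P.extMk_eq_zero_iff (adj.homEquiv _ _ f) (n + 2) rfl hf' n rfl).1
        (Subsingleton.elim _ _)
      refine ⟨(adj.homEquiv _ _).symm g, ?_⟩
      change L.map _ ≫ _ = f
      rw [← adj.homEquiv_naturality_left_symm, hg, Equiv.symm_apply_apply]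

end Adjunction

section Evaluation

variable {J : Type u₂} [Category.{v₂} J]

/-- Short exactness in a functor category is checked pointwise. -/
theorem shortExact_iff_evaluation (S : ShortComplex (J ⥤ A)) :
    S.ShortExact ↔ ∀ j, (S.map ((evaluation J A).obj j)).ShortExact :=
  JointlyReflectIsomorphisms.shortExact_iff (F := fun j => (evaluation J A).obj j)
    ⟨fun f h => (NatTrans.isIso_iff_isIso_app f).2 h⟩ S

/-- A coproduct of short exact sequences is short exact if coproducts are exact. -/
theorem shortExact_sigma {ι : Type*} [HasColimitsOfShape (Discrete ι) A]
    [HasExactColimitsOfShape (Discrete ι) A] (S : ι → ShortComplex A)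
    (hS : ∀ s, (S s).ShortExact) :
    (ShortComplex.mk (Limits.Sigma.map fun s => (S s).f) (Limits.Sigma.map fun s => (S s).g)
      (Sigma.hom_ext _ _ fun s => by simp)).ShortExact :=
  let T : ShortComplex (Discrete ι ⥤ A) :=
    { X₁ := Discrete.functor fun s => (S s).X₁
      X₂ := Discrete.functor fun s => (S s).X₂
      X₃ := Discrete.functor fun s => (S s).X₃
      f := Discrete.natTrans fun s => (S s.as).f
      g := Discrete.natTrans fun s => (S s.as).g
      zero := by
        ext s
        exact (S s.as).zero }
  ((shortExact_iff_evaluation T).2 fun s => hS s.as).map_of_exact colim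

end Evaluation

section Ext

variable [HasExt.{w} A] {N : A}

theorem subsingleton_ext_of_iso {Y Y' : A} (e : Y ≅ Y') {n : ℕ}
    (h : Subsingleton (Ext.{w} Y N n)) : Subsingleton (Ext.{w} Y' N n) := by
  refine subsingleton_of_forall_eq 0 fun x => ?_
  have h1 : (Ext.mk₀ e.inv).comp ((Ext.mk₀ e.hom).comp x (zero_add n)) (zero_add n) = x := by
    simp [Ext.mk₀_comp_mk₀_assoc]
  rw [← h1, Subsingleton.elim ((Ext.mk₀ e.hom).comp x (zero_add n)) 0, Ext.comp_zero]

theorem subsingleton_ext_of_isZero {Y : A} (h : IsZero Y) (n : ℕ) :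
    Subsingleton (Ext.{w} Y N n) := by
  refine subsingleton_of_forall_eq 0 fun x => ?_
  rw [← Ext.mk₀_id_comp x, h.eq_of_src (𝟙 Y) 0, Ext.mk₀_zero, Ext.zero_comp]

theorem subsingleton_ext_middle {S : ShortComplex A} (hS : S.ShortExact) {n : ℕ}
    (h₁ : Subsingleton (Ext.{w} S.X₁ N n)) (h₃ : Subsingleton (Ext.{w} S.X₃ N n)) :
    Subsingleton (Ext.{w} S.X₂ N n) := by
  refine subsingleton_of_forall_eq 0 fun x => ?_
  obtain ⟨y, rfl⟩ := Ext.contravariant_sequence_exact₂ hS N x (Subsingleton.elim _ _)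
  rw [Subsingleton.elim y 0, Ext.comp_zero]

/-- `Ext^n` of the quotient lies between `Ext^(n-1)` of the subobject and `Ext^n` of the middle
term. Writing the first condition as `m < n` makes it empty in degree zero. -/
theorem subsingleton_ext_right {S : ShortComplex A} (hS : S.ShortExact) {n : ℕ}
    (h₁ : ∀ m < n, Subsingleton (Ext.{w} S.X₁ N m)) (h₂ : Subsingleton (Ext.{w} S.X₂ N n)) :
    Subsingleton (Ext.{w} S.X₃ N n) := by
  refine subsingleton_of_forall_eq 0 fun x => ?_
  cases n with
  | zero =>
    have := hS.epi_g
    exact Ext.precomp_mk₀_injective_of_epi N S.g (Subsingleton.elim (α := Ext S.X₂ N 0) _ _)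
  | succ n =>
    have := h₁ n n.lt_succ_self
    obtain ⟨y, rfl⟩ := Ext.contravariant_sequence_exact₃ hS N x (Subsingleton.elim _ _)
      (add_comm 1 n)
    rw [Subsingleton.elim y 0, Ext.comp_zero]

theorem subsingleton_ext_left {S : ShortComplex A} (hS : S.ShortExact) {n : ℕ}
    (h₂ : Subsingleton (Ext.{w} S.X₂ N n)) (h₃ : Subsingleton (Ext.{w} S.X₃ N (n + 1))) :
    Subsingleton (Ext.{w} S.X₁ N n) := by
  refine subsingleton_of_forall_eq 0 fun x => ?_
  obtain ⟨y, rfl⟩ := Ext.contravariant_sequence_exact₁ hS N x (add_comm 1 n)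
    (Subsingleton.elim _ _)
  rw [Subsingleton.elim y 0, Ext.comp_zero]

/-- Vanishing of `Ext` groups along a morphism with given kernel, source and cokernel. -/
theorem subsingleton_ext_of_kernel_cokernel {D Y : A} (θ : D ⟶ Y) {n : ℕ}
    (hK : ∀ m < n, Subsingleton (Ext.{w} (kernel θ) N m)) (hD : Subsingleton (Ext.{w} D N n))
    (hQ : Subsingleton (Ext.{w} (cokernel θ) N n)) : Subsingleton (Ext.{w} Y N n) := by
  let S : ShortComplex A := ShortComplex.mk (kernel.ι θ) (Abelian.factorThruImage θ)
    (by rw [← cancel_mono (Abelian.image.ι θ)]; simp)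
  have hS : S.ShortExact :=
    { exact := by
        have hk {W : A} (k : W ⟶ D) (hk : k ≫ Abelian.factorThruImage θ = 0) : k ≫ θ = 0 := by
          rw [← Abelian.image.fac θ, reassoc_of% hk, zero_comp]
        exact ShortComplex.exact_of_f_is_kernel _ (KernelFork.IsLimit.ofι' _ _ fun k h =>
          ⟨kernel.lift _ k (hk k h), kernel.lift_ι _ _ _⟩) }
  let S' : ShortComplex A := ShortComplex.mk (Abelian.image.ι θ) (cokernel.π θ)
    (by simp [Abelian.image.ι])
  have hS' : S'.ShortExact :=
    { exact := ShortComplex.exact_of_f_is_kernel _ (kernelIsKernel (cokernel.π θ)) }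
  -- The image is a quotient of `D` by the kernel, which is why the kernel enters only in degrees
  -- below `n`.
  exact subsingleton_ext_middle hS' (subsingleton_ext_right hS hK hD) hQ

/-- `Ext` groups out of a coproduct vanish if those out of all the terms do. -/
theorem subsingleton_ext_sigma [EnoughProjectives A] {ι : Type v₁}
    [HasColimitsOfShape (Discrete ι) A] [HasExactColimitsOfShape (Discrete ι) A] (n : ℕ)
    (Y : ι → A) (h : ∀ s, Subsingleton (Ext.{w} (Y s) N n)) :
    Subsingleton (Ext.{w} (∐ Y) N n) := by
  induction n generalizing Y with
  | zero =>
    have (s : ι) : Subsingleton (Y s ⟶ N) :=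
      have := h s
      Ext.addEquiv₀.symm.toEquiv.injective.subsingleton
    have : Subsingleton (∐ Y ⟶ N) := ⟨fun f g => Sigma.hom_ext _ _ fun s => Subsingleton.elim _ _⟩
    exact Ext.addEquiv₀.toEquiv.injective.subsingleton
  | succ n ih =>
    let p (s : ι) : Projective.over (Y s) ⟶ Y s := Projective.π (Y s)
    have hp (s : ι) : (ShortComplex.mk _ _ (kernel.condition (p s))).ShortExact :=
      { exact := ShortComplex.exact_of_f_is_kernel _ (kernelIsKernel _) }
    have hS := shortExact_sigma _ hp
    refine subsingleton_of_forall_eq 0 fun x => ?_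
    obtain ⟨y, rfl⟩ := Ext.contravariant_sequence_exact₃ hS N x
      (Ext.eq_zero_of_projective (P := ∐ fun s => Projective.over (Y s)) _) (add_comm 1 n)
    -- For `y` of positive degree, the dimension shift makes `Ext` of each kernel vanish and
    -- induction applies. In degree zero the kernels may have nonzero morphisms to `N`, so each
    -- component of `y` is instead extended to its projective cover term.
    cases n with
    | zero =>
      obtain ⟨f, rfl⟩ := Ext.addEquiv₀.symm.surjective y
      have hg (s : ι) : ∃ g : Projective.over (Y s) ⟶ N,
          kernel.ι (p s) ≫ g = Limits.Sigma.ι (fun s => kernel (p s)) s ≫ f := by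
        obtain ⟨z, hz⟩ := Ext.contravariant_sequence_exact₁ (hp s) N
          (Ext.mk₀ (Limits.Sigma.ι (fun s => kernel (p s)) s ≫ f)) (add_comm 1 0)
          (have := h s; Subsingleton.elim _ _)
        obtain ⟨g, rfl⟩ := Ext.addEquiv₀.symm.surjective z
        refine ⟨g, Ext.addEquiv₀.symm.injective ?_⟩
        simpa [Ext.mk₀_comp_mk₀] using hz
      choose g hg using hg
      have hf : (Limits.Sigma.map fun s => kernel.ι (p s)) ≫ Limits.Sigma.desc g = f :=
        Sigma.hom_ext _ _ fun s => by simp [hg]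
      obtain rfl := hf
      exact (congrArg (fun t => hS.extClass.comp t (add_comm 1 0))
        (Ext.mk₀_comp_mk₀ _ _)).symm.trans (ShortComplex.ShortExact.extClass_comp_assoc _ _)
    | succ n =>
      have := ih (fun s => kernel (p s)) fun s => subsingleton_ext_left (hp s)
        (Ext.subsingleton_of_projective _ _ _) (h s)
      have hy : y = 0 := this.elim _ _
      rw [hy, Ext.comp_zero]

end Ext

end ExtVanishing

/-! ### The adjunction between `X ⊗_C -` and `Hom_k(X, -)`. -/

section TensorOverAdjunction

variable {k : Type u} [CommRing k] {C : Type u} [SmallCategory C]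

/-- The functor `M ↦ Hom_k(X(-), M)`. -/
noncomputable def homFrom (X : Cᵒᵖ ⥤ ModuleCat.{u} k) :
    ModuleCat.{u} k ⥤ (C ⥤ ModuleCat.{u} k) where
  obj M :=
    { obj c := ModuleCat.of k (X.obj (op c) →ₗ[k] M)
      map f := ModuleCat.ofHom (LinearMap.lcomp k M (X.map f.op).hom)
      map_id c := by ext; simp
      map_comp f g := by ext; simp }
  map g :=
    { app c := ModuleCat.ofHom (LinearMap.compRight k g.hom) }

theorem lift_dinatural (X : Cᵒᵖ ⥤ ModuleCat.{u} k) {F : C ⥤ ModuleCat.{u} k}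
    {M : ModuleCat.{u} k} (η : F ⟶ (homFrom X).obj M) ⦃c d : C⦄ (f : c ⟶ d) :
    (((externalTensor X).obj F).map f.op).app c ≫
        ModuleCat.ofHom (TensorProduct.lift (LinearMap.flip (η.app c).hom)) =
      (((externalTensor X).obj F).obj (op d)).map f ≫
        ModuleCat.ofHom (TensorProduct.lift (LinearMap.flip (η.app d).hom)) := by
  refine ModuleCat.hom_ext (TensorProduct.ext' fun y x => ?_)
  exact (congrArg (fun s => (s.hom x : X.obj (op d) →ₗ[k] M) y) (η.naturality f)).symm

/-- The morphism `X ⊗_C F ⟶ M` attached to a natural transformation `F ⟶ Hom_k(X(-), M)`. -/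
noncomputable def tensorOverDesc (X : Cᵒᵖ ⥤ ModuleCat.{u} k) {F : C ⥤ ModuleCat.{u} k}
    {M : ModuleCat.{u} k} (η : F ⟶ (homFrom X).obj M) : (tensorOver X).obj F ⟶ M :=
  coend.desc (fun c => ModuleCat.ofHom (TensorProduct.lift (LinearMap.flip (η.app c).hom)))
    (lift_dinatural X η)

theorem ι_tensorOverDesc (X : Cᵒᵖ ⥤ ModuleCat.{u} k) {F : C ⥤ ModuleCat.{u} k}
    {M : ModuleCat.{u} k} (η : F ⟶ (homFrom X).obj M) (c : C) :
    coend.ι ((externalTensor X).obj F) c ≫ tensorOverDesc X η =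
      ModuleCat.ofHom (TensorProduct.lift (LinearMap.flip (η.app c).hom)) :=
  coend.ι_desc _ (lift_dinatural X η) c

/-- The natural transformation `F ⟶ Hom_k(X(-), M)` attached to a morphism `X ⊗_C F ⟶ M`. -/
noncomputable def tensorOverCurry (X : Cᵒᵖ ⥤ ModuleCat.{u} k) {F : C ⥤ ModuleCat.{u} k}
    {M : ModuleCat.{u} k} (t : (tensorOver X).obj F ⟶ M) : F ⟶ (homFrom X).obj M where
  app c := ModuleCat.ofHom (LinearMap.flip ((TensorProduct.mk k (X.obj (op c)) (F.obj c)).compr₂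
    (coend.ι ((externalTensor X).obj F) c ≫ t).hom))
  naturality c d f := by
    have h := coend.condition ((externalTensor X).obj F) f
    refine ModuleCat.hom_ext (LinearMap.ext fun x => LinearMap.ext fun y => ?_)
    exact (congrArg (fun s => t.hom (s.hom ((y : X.obj (op d)) ⊗ₜ[k] (x : F.obj c)))) h).symm

/-- The universal property of the tensor product over `C`. -/
noncomputable def tensorOverHomEquiv (X : Cᵒᵖ ⥤ ModuleCat.{u} k) (F : C ⥤ ModuleCat.{u} k)
    (M : ModuleCat.{u} k) : ((tensorOver X).obj F ⟶ M) ≃ (F ⟶ (homFrom X).obj M) where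
  toFun t := tensorOverCurry X t
  invFun η := tensorOverDesc X η
  left_inv t := coend.hom_ext fun c => (ι_tensorOverDesc X (tensorOverCurry X t) c).trans
    (ModuleCat.hom_ext (TensorProduct.ext' fun y x => rfl))
  right_inv η := by
    refine NatTrans.ext (funext fun c => ?_)
    refine ModuleCat.hom_ext (LinearMap.ext fun x => LinearMap.ext fun y => ?_)
    exact congrArg (fun s : (((externalTensor X).obj F).obj (op c)).obj c ⟶ M =>
      s.hom ((y : X.obj (op c)) ⊗ₜ[k] (x : F.obj c))) (ι_tensorOverDesc X η c)

/-- The functor `X ⊗_C -` is left adjoint to `M ↦ Hom_k(X(-), M)`. -/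
noncomputable def tensorOverAdjunction (X : Cᵒᵖ ⥤ ModuleCat.{u} k) :
    tensorOver X ⊣ homFrom X :=
  Adjunction.mkOfHomEquiv
    { homEquiv := tensorOverHomEquiv X
      homEquiv_naturality_left_symm := fun {F F' M} f g => by
        refine coend.hom_ext fun c => ?_
        refine (ι_tensorOverDesc X (f ≫ g) c).trans ?_
        refine Eq.trans ?_ (coend.ι_map_assoc ((externalTensor X).map f) c _).symm
        refine Eq.trans ?_ (congrArg (fun t => (((externalTensor X).map f).app (op c)).app c ≫ t)
          (ι_tensorOverDesc X g c).symm)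
        exact ModuleCat.hom_ext (TensorProduct.ext' fun y x => rfl)
      homEquiv_naturality_right := fun f g => rfl }

end TensorOverAdjunction

/-! ### Acyclicity of `E ⊗ G` for flat-valued `E` and arbitrary `G`. -/

section ExtTensor

open Abelian

variable {k : Type} [CommRing k]

instance : HasExt.{0} (Gr ⥤ ModuleCat.{0} k) := hasExt_of_enoughProjectives _

/-- The abelianization of a free group is free abelian on the same generators; the resulting
flatness makes `𝔞 ⊗ -` exact. -/
instance (X : Gr) : Module.Free k ((abelianization k).obj X) :=
  have : Module.Free ℤ (Additive (Abelianization X.toGroup)) :=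
    Module.Free.of_basis (FreeAbelianGroup.basis (Fin X.rank))
  inferInstanceAs (Module.Free k (k ⊗[ℤ] Additive (Abelianization X.toGroup)))

/-- Every functor is the target of a surjection from a direct sum of functors `P_n`. -/
noncomputable def coprodProjDesc (G : Gr ⥤ ModuleCat.{0} k) :
    (∐ fun p : Σ n : ℕ, G.obj (Gr.mk n) => P k p.1) ⟶ G :=
  Sigma.desc fun p => stdProjDesc p.2

instance (G : Gr ⥤ ModuleCat.{0} k) : Epi (coprodProjDesc G) := by
  rw [NatTrans.epi_iff_epi_app]
  rintro ⟨n⟩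
  rw [ModuleCat.epi_iff_surjective]
  intro x
  refine ⟨(Sigma.ι (fun p : Σ n : ℕ, G.obj (Gr.mk n) => P k p.1) ⟨n, x⟩).app _
    (ModuleCat.freeMk (𝟙 _)), ?_⟩
  have h := congrArg (fun t => t.app (Gr.mk n) (ModuleCat.freeMk (𝟙 _)))
    (Sigma.ι_desc (fun p : Σ n : ℕ, G.obj (Gr.mk n) => stdProjDesc (k := k) p.2) ⟨n, x⟩)
  refine h.trans ((stdProjDesc_freeMk x (𝟙 _)).trans ?_)
  rw [CategoryTheory.Functor.map_id, ModuleCat.id_apply]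

/-- Tensoring with a functor with flat values is exact. -/
theorem shortExact_tensorLeft (E : Gr ⥤ ModuleCat.{0} k) [∀ X, Module.Flat k (E.obj X)]
    {S : ShortComplex (Gr ⥤ ModuleCat.{0} k)} (hS : S.ShortExact) :
    (ShortComplex.mk (E ◁ S.f) (E ◁ S.g) (by
      rw [← MonoidalCategory.whiskerLeft_comp, S.zero]
      ext X : 2
      exact ModuleCat.hom_ext (LinearMap.lTensor_zero _))).ShortExact := by
  rw [shortExact_iff_evaluation] at hS ⊢
  intro X
  have h := hS X
  refine ModuleCat.shortComplex_shortExact _ ?_ ?_ ?_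
  · exact lTensor_exact _ ((ShortComplex.ShortExact.moduleCat_exact_iff_function_exact _).1 h.exact)
      h.moduleCat_surjective_g
  · exact Module.Flat.lTensor_preserves_injective_linearMap _ h.moduleCat_injective_f
  · exact LinearMap.lTensor_surjective _ h.moduleCat_surjective_g

/-- Dimension shift along a surjection from a sum of functors `P_n` onto `G`: the kernel is
arbitrary, but occurs only in lower degrees, where all functors are already covered. -/
theorem subsingleton_ext_tensor (E N : Gr ⥤ ModuleCat.{0} k) [∀ X, Module.Flat k (E.obj X)]
    (h : ∀ n i : ℕ, Subsingleton (Ext.{0} (E ⊗ P k n) N i)) (G : Gr ⥤ ModuleCat.{0} k) (i : ℕ) :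
    Subsingleton (Ext.{0} (E ⊗ G) N i) := by
  induction i using Nat.strong_induction_on generalizing G with
  | _ i ih =>
  have hS : (ShortComplex.mk _ _ (kernel.condition (coprodProjDesc G))).ShortExact :=
    { exact := ShortComplex.exact_of_f_is_kernel _ (kernelIsKernel _) }
  refine subsingleton_ext_right (shortExact_tensorLeft E hS) (fun m hm => ih m hm _) ?_
  -- Closedness makes `E ⊗ -` a left adjoint, so it commutes with the coproduct.
  let : MonoidalClosed (Gr ⥤ ModuleCat.{0} k) := Functor.functorCategoryMonoidalClosed _ _
  exact subsingleton_ext_of_iso (PreservesCoproduct.iso (tensorLeft E) _).symm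
    (subsingleton_ext_sigma i _ fun p => h p.1 i)

end ExtTensor

/-! ### Calculus of free products in `gr`. -/

namespace Gr

/-- The free product of two free groups of finite rank. -/
abbrev add (X Y : Gr) : Gr := mk (X.rank + Y.rank)

/-- The inclusion of the first free factor. -/
def inl (X Y : Gr) : X ⟶ add X Y := (binaryCofan X Y).inl

/-- The inclusion of the second free factor. -/
def inr (X Y : Gr) : Y ⟶ add X Y := (binaryCofan X Y).inr

/-- The morphism out of a free product given by morphisms on the two factors. -/
def desc {X Y Z : Gr} (f : X ⟶ Z) (g : Y ⟶ Z) : add X Y ⟶ Z :=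
  (isColimitBinaryCofan X Y).desc (BinaryCofan.mk f g)

@[simp]
theorem inl_desc {X Y Z : Gr} (f : X ⟶ Z) (g : Y ⟶ Z) :
    inl X Y ≫ desc f g = f :=
  (isColimitBinaryCofan X Y).fac (BinaryCofan.mk f g) ⟨WalkingPair.left⟩

@[simp]
theorem inl_desc_assoc {X Y Z W : Gr} (f : X ⟶ Z) (g : Y ⟶ Z)
    (h : Z ⟶ W) : inl X Y ≫ desc f g ≫ h = f ≫ h := by
  rw [← Category.assoc, inl_desc]

@[simp]
theorem inr_desc {X Y Z : Gr} (f : X ⟶ Z) (g : Y ⟶ Z) :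
    inr X Y ≫ desc f g = g :=
  (isColimitBinaryCofan X Y).fac (BinaryCofan.mk f g) ⟨WalkingPair.right⟩

@[simp]
theorem inr_desc_assoc {X Y Z W : Gr} (f : X ⟶ Z) (g : Y ⟶ Z)
    (h : Z ⟶ W) : inr X Y ≫ desc f g ≫ h = g ≫ h := by
  rw [← Category.assoc, inr_desc]

theorem add_hom_ext {X Y Z : Gr} {f g : add X Y ⟶ Z} (h₁ : inl X Y ≫ f = inl X Y ≫ g)
    (h₂ : inr X Y ≫ f = inr X Y ≫ g) : f = g :=
  BinaryCofan.IsColimit.hom_ext (isColimitBinaryCofan X Y) h₁ h₂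

/-- The free product of two morphisms. -/
def addMap {X Y X' Y' : Gr} (f : X ⟶ X') (g : Y ⟶ Y') : add X Y ⟶ add X' Y' :=
  desc (f ≫ inl X' Y') (g ≫ inr X' Y')

@[simp]
theorem inl_addMap {X Y X' Y' : Gr} (f : X ⟶ X') (g : Y ⟶ Y') :
    inl X Y ≫ addMap f g = f ≫ inl X' Y' := inl_desc _ _

@[simp]
theorem inl_addMap_assoc {X Y X' Y' W : Gr} (f : X ⟶ X') (g : Y ⟶ Y')
    (h : add X' Y' ⟶ W) : inl X Y ≫ addMap f g ≫ h = f ≫ inl X' Y' ≫ h := by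
  rw [← Category.assoc, inl_addMap, Category.assoc]

@[simp]
theorem inr_addMap {X Y X' Y' : Gr} (f : X ⟶ X') (g : Y ⟶ Y') :
    inr X Y ≫ addMap f g = g ≫ inr X' Y' := inr_desc _ _

@[simp]
theorem inr_addMap_assoc {X Y X' Y' W : Gr} (f : X ⟶ X') (g : Y ⟶ Y')
    (h : add X' Y' ⟶ W) : inr X Y ≫ addMap f g ≫ h = g ≫ inr X' Y' ≫ h := by
  rw [← Category.assoc, inr_addMap, Category.assoc]

@[simp]
theorem addMap_id (X Y : Gr) : addMap (𝟙 X) (𝟙 Y) = 𝟙 (add X Y) :=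
  add_hom_ext (by simp) (by simp)

theorem addMap_comp {X Y X' Y' X'' Y'' : Gr} (f : X ⟶ X') (g : Y ⟶ Y') (f' : X' ⟶ X'')
    (g' : Y' ⟶ Y'') : addMap (f ≫ f') (g ≫ g') = addMap f g ≫ addMap f' g' :=
  add_hom_ext (by simp) (by simp)

/-- The projection onto the first free factor. -/
def pr₁ (X Y : Gr) : add X Y ⟶ X := desc (𝟙 X) 0

/-- The projection onto the second free factor. -/
def pr₂ (X Y : Gr) : add X Y ⟶ Y := desc 0 (𝟙 Y)

@[simp]
theorem inl_pr₁ (X Y : Gr) :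
    inl X Y ≫ pr₁ X Y = 𝟙 X := inl_desc _ _

@[simp]
theorem inl_pr₁_assoc (X Y : Gr) {W : Gr}
    (h : X ⟶ W) : inl X Y ≫ pr₁ X Y ≫ h = h := by
  rw [← Category.assoc, inl_pr₁, Category.id_comp]

@[simp]
theorem inr_pr₁ (X Y : Gr) :
    inr X Y ≫ pr₁ X Y = 0 := inr_desc _ _

@[simp]
theorem inr_pr₁_assoc (X Y : Gr) {W : Gr}
    (h : X ⟶ W) : inr X Y ≫ pr₁ X Y ≫ h = 0 := by
  rw [← Category.assoc, inr_pr₁, zero_comp]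

@[simp]
theorem inl_pr₂ (X Y : Gr) :
    inl X Y ≫ pr₂ X Y = 0 := inl_desc _ _

@[simp]
theorem inl_pr₂_assoc (X Y : Gr) {W : Gr}
    (h : Y ⟶ W) : inl X Y ≫ pr₂ X Y ≫ h = 0 := by
  rw [← Category.assoc, inl_pr₂, zero_comp]

@[simp]
theorem inr_pr₂ (X Y : Gr) :
    inr X Y ≫ pr₂ X Y = 𝟙 Y := inr_desc _ _

@[simp]
theorem inr_pr₂_assoc (X Y : Gr) {W : Gr}
    (h : Y ⟶ W) : inr X Y ≫ pr₂ X Y ≫ h = h := by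
  rw [← Category.assoc, inr_pr₂, Category.id_comp]

theorem addMap_pr₁ {X Y X' Y' : Gr} (f : X ⟶ X') (g : Y ⟶ Y') :
    addMap f g ≫ pr₁ X' Y' = pr₁ X Y ≫ f :=
  add_hom_ext (by simp) (by simp)

theorem addMap_pr₂ {X Y X' Y' : Gr} (f : X ⟶ X') (g : Y ⟶ Y') :
    addMap f g ≫ pr₂ X' Y' = pr₂ X Y ≫ g :=
  add_hom_ext (by simp) (by simp)

/-! ### Coloured generators and the idempotents that kill a colour. -/

variable {ι : Type} [DecidableEq ι]

/-- The endomorphism which kills the generators of colour `i`. -/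
def kill {X : Gr} (χ : Fin X.rank → ι) (i : ι) : X ⟶ X :=
  ofHom (FreeGroup.lift fun a => if χ a = i then 1 else FreeGroup.of a)

@[simp]
theorem hom_kill {X : Gr} (χ : Fin X.rank → ι) (i : ι) (a : Fin X.rank) :
    hom (kill χ i) (FreeGroup.of a) = if χ a = i then 1 else FreeGroup.of a :=
  FreeGroup.lift_apply_of

theorem hom_comp {X Y Z : Gr} (f : X ⟶ Y) (g : Y ⟶ Z) (x : X.toGroup) :
    hom (f ≫ g) x = hom g (hom f x) := rfl

theorem hom_zero {X Y : Gr} (x : X.toGroup) : hom (0 : X ⟶ Y) x = 1 := rfl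

theorem hom_id {X : Gr} (x : X.toGroup) : hom (𝟙 X) x = x := rfl

theorem kill_comp_kill {X : Gr} (χ : Fin X.rank → ι) (i j : ι) :
    kill χ i ≫ kill χ j = kill χ j ≫ kill χ i := by
  refine hom_ext fun a => ?_
  rw [hom_comp, hom_comp, hom_kill, hom_kill]
  split_ifs <;> simp [*]

theorem kill_comp_self {X : Gr} (χ : Fin X.rank → ι) (i : ι) :
    kill χ i ≫ kill χ i = kill χ i := by
  refine hom_ext fun a => ?_
  rw [hom_comp, hom_kill]
  split_ifs <;> simp [*]

theorem kill_eq_zero {X : Gr} (χ : Fin X.rank → ι) (i : ι) (h : ∀ a, χ a = i) :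
    kill χ i = 0 :=
  hom_ext fun a => by rw [hom_kill, if_pos (h a), hom_zero]

theorem kill_eq_id {X : Gr} (χ : Fin X.rank → ι) (i : ι) (h : ∀ a, χ a ≠ i) :
    kill χ i = 𝟙 X :=
  hom_ext fun a => by rw [hom_kill, if_neg (h a), hom_id]

theorem hom_inl {X Y : Gr} (a : Fin X.rank) :
    hom (inl X Y) (FreeGroup.of a) = FreeGroup.of (Fin.castAdd Y.rank a) :=
  FreeGroup.map.of

theorem hom_inr {X Y : Gr} (a : Fin Y.rank) :
    hom (inr X Y) (FreeGroup.of a) = FreeGroup.of (Fin.natAdd X.rank a) :=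
  FreeGroup.map.of

theorem kill_addCases {X Y : Gr} (χ : Fin X.rank → ι) (χ' : Fin Y.rank → ι) (i : ι) :
    kill (X := add X Y) (Fin.addCases χ χ') i = addMap (kill χ i) (kill χ' i) := by
  refine add_hom_ext ?_ ?_
  · rw [inl_addMap]
    refine hom_ext fun a => ?_
    rw [hom_comp, hom_comp, hom_inl, hom_kill, hom_kill, Fin.addCases_left]
    split_ifs <;> simp [hom_inl]
  · rw [inr_addMap]
    refine hom_ext fun a => ?_
    rw [hom_comp, hom_comp, hom_inr, hom_kill, hom_kill, Fin.addCases_right]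
    split_ifs <;> simp [hom_inr]

end Gr

open Gr

/-! ### Polynomial degree in terms of colours. -/

section Degree

variable {k : Type} [CommRing k]

/-- A colour-by-colour form of being polynomial of degree at most `d`. -/
theorem IsPolynomialOfDegreeLE.eq_zero_of_kill {F : Gr ⥤ ModuleCat.{0} k} {d : ℕ}
    (hF : IsPolynomialOfDegreeLE F d) {A : Gr} (χ : Fin A.rank → Fin (d + 1)) (x : F.obj A)
    (hx : ∀ i, (F.map (kill χ i)).hom x = 0) : x = 0 := by
  let c : Fin (d + 1) → Gr := fun _ => A
  -- Each generator goes to the copy of `A` indexed by its colour; folding the copies is a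
  -- retraction, so `F(ψ)` is injective.
  let ψ : A ⟶ ∐ c := ofHom (FreeGroup.lift fun a => hom (Limits.Sigma.ι c (χ a)) (FreeGroup.of a))
  let φ : ∐ c ⟶ A := Limits.Sigma.desc fun _ => 𝟙 A
  have hψ (a : Fin A.rank) :
      hom ψ (FreeGroup.of a) = hom (Limits.Sigma.ι c (χ a)) (FreeGroup.of a) :=
    FreeGroup.lift_apply_of
  have h1 : ψ ≫ φ = 𝟙 A := hom_ext fun a => by
    rw [hom_comp, hψ, ← hom_comp, Limits.Sigma.ι_desc]
  -- Generators of colour `i` die in the collapse anyway, so killing them first changes nothing;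
  -- hence `F(ψ) x` lies in the cross-effect.
  have h2 (i) : ψ ≫ collapse c i = kill χ i ≫ ψ ≫ collapse c i := hom_ext fun a => by
    rw [hom_comp (kill χ i), hom_kill]
    split_ifs with h
    · rw [hom_comp, hψ, ← hom_comp, collapse, Limits.Sigma.ι_desc, dif_pos h, hom_zero, map_one]
    · rfl
  have h3 : (F.map ψ).hom x ∈ crossEffect F (d + 1) c := by
    rw [crossEffect, Submodule.mem_iInf]
    intro i
    rw [LinearMap.mem_ker, ← ModuleCat.comp_apply, ← F.map_comp, h2, F.map_comp,
      ModuleCat.comp_apply, hx, map_zero]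
  rw [hF c, Submodule.mem_bot] at h3
  have h4 : (F.map φ).hom ((F.map ψ).hom x) = x := by
    rw [← ModuleCat.comp_apply, ← F.map_comp, h1, F.map_id, ModuleCat.id_apply]
  rw [← h4, h3, map_zero]

theorem IsReduced.map_zero {F : Gr ⥤ ModuleCat.{0} k} (hF : IsReduced F) (A A' : Gr) :
    F.map (0 : A ⟶ A') = 0 := by
  have h : (0 : A ⟶ A') = (0 : A ⟶ 0) ≫ (0 : (0 : Gr) ⟶ A') := by simp
  rw [h, F.map_comp]
  exact (congrArg (· ≫ _) (hF.eq_of_tgt _ 0)).trans zero_comp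

/-- A common kernel of commuting idempotents which vanishes still vanishes after tensoring. -/
theorem eq_zero_of_rTensor_eq_zero {V M : Type*} [AddCommGroup V] [AddCommGroup M] [Module k V]
    [Module k M] {n : ℕ} (e : Fin n → Module.End k V) (hc : ∀ i j, e i * e j = e j * e i)
    (hi : ∀ i, e i * e i = e i) (h : ∀ v, (∀ i, e i v = 0) → v = 0) (x : V ⊗[k] M)
    (hx : ∀ i, (e i).rTensor M x = 0) : x = 0 := by
  -- The product of the `1 - e j` projects onto the common kernel, so it is zero on `V`; after
  -- tensoring it fixes `x`. Operator identities survive any tensor product, so `M` need not be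
  -- flat.
  have h1 (l : List (Fin n)) : ∀ i ∈ l, e i * (l.map fun j => 1 - e j).prod = 0 := by
    induction l with
    | nil => simp
    | cons j l ih =>
      intro i hil
      rw [List.map_cons, List.prod_cons, ← mul_assoc, mul_sub, mul_one]
      rcases List.mem_cons.1 hil with rfl | hil
      · rw [hi, sub_self, zero_mul]
      · rw [hc, sub_mul, mul_assoc, ih i hil, mul_zero, sub_zero]
  have h2 : ((List.finRange n).map fun j => 1 - e j).prod = 0 :=
    LinearMap.ext fun v => h _ fun i =>
      LinearMap.congr_fun (h1 (List.finRange n) i (List.mem_finRange i)) v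
  have h3 (l : List (Fin n)) :
      (Module.End.rTensorAlgHom k V M (l.map fun j => 1 - e j).prod) x = x := by
    induction l with
    | nil => simp
    | cons j l ih =>
      rw [List.map_cons, List.prod_cons, map_mul, Module.End.mul_apply, ih, map_sub, map_one,
        LinearMap.sub_apply]
      exact (congrArg (x - ·) (hx j)).trans (sub_zero x)
  rw [← h3 (List.finRange n), h2, map_zero, LinearMap.zero_apply]

end Degree

/-! ### Bifunctors reduced or polynomial in the first variable. -/

section Bifunctor

variable {k : Type} [CommRing k]

/-- The action of a pair of morphisms on a bifunctor. -/
def bimap (B : Gr × Gr ⥤ ModuleCat.{0} k) {X X' Y Y' : Gr} (f : X ⟶ X') (g : Y ⟶ Y') :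
    B.obj (X, Y) →ₗ[k] B.obj (X', Y') :=
  (B.map (Prod.mkHom f g)).hom

variable (B : Gr × Gr ⥤ ModuleCat.{0} k)

theorem bimap_id {X Y : Gr} (x : B.obj (X, Y)) : bimap B (𝟙 X) (𝟙 Y) x = x :=
  congrArg (fun t => t.hom x) (B.map_id (X, Y))

theorem bimap_bimap {X X' X'' Y Y' Y'' : Gr} (f : X ⟶ X') (g : Y ⟶ Y') (f' : X' ⟶ X'')
    (g' : Y' ⟶ Y'') (x : B.obj (X, Y)) :
    bimap B f' g' (bimap B f g x) = bimap B (f ≫ f') (g ≫ g') x :=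
  (congrArg (fun t => t.hom x) (B.map_comp (Prod.mkHom f g) (Prod.mkHom f' g'))).symm

theorem bimap_naturality {B B' : Gr × Gr ⥤ ModuleCat.{0} k} (η : B ⟶ B') {X X' Y Y' : Gr}
    (f : X ⟶ X') (g : Y ⟶ Y') (x : B.obj (X, Y)) :
    (η.app (X', Y')).hom (bimap B f g x) = bimap B' f g ((η.app (X, Y)).hom x) :=
  congrArg (fun t => t.hom x) (η.naturality (Prod.mkHom f g))

/-- A bifunctor is reduced in the first variable. -/
def ReducedLeft : Prop :=
  ∀ (X X' Y : Gr) (x : B.obj (X, Y)), bimap B (0 : X ⟶ X') (𝟙 Y) x = 0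

/-- A bifunctor is polynomial of degree at most `d` in the first variable. -/
def DegreeLeftLE (d : ℕ) : Prop :=
  ∀ (X Y : Gr) (χ : Fin X.rank → Fin (d + 1)) (x : B.obj (X, Y)),
    (∀ i, bimap B (kill χ i) (𝟙 Y) x = 0) → x = 0

variable {B}

theorem ReducedLeft.of_injective (h : ReducedLeft B) (η : B' ⟶ B)
    (hη : ∀ X Y, Function.Injective (η.app (X, Y)).hom) : ReducedLeft B' := fun X X' Y x =>
  hη _ _ (by rw [bimap_naturality, h, map_zero])

theorem DegreeLeftLE.of_injective {d : ℕ} (h : DegreeLeftLE B d) (η : B' ⟶ B)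
    (hη : ∀ X Y, Function.Injective (η.app (X, Y)).hom) : DegreeLeftLE B' d :=
  fun X Y χ x hx => hη _ _ <| (h X Y χ _ fun i => by
    rw [← bimap_naturality, hx, map_zero]).trans (map_zero _).symm

/-- With a single colour, killing it is the zero endomorphism, which acts by zero on a reduced
functor. -/
theorem DegreeLeftLE.isZero (h : DegreeLeftLE B 0) (h' : ReducedLeft B) : IsZero B := by
  rw [Functor.isZero_iff]
  rintro ⟨X, Y⟩
  have : Subsingleton (B.obj (X, Y)) := subsingleton_of_forall_eq 0 fun x =>
    h X Y (fun _ => 0) x fun i => by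
      rw [kill_eq_zero _ _ fun _ => (Fin.eq_zero i).symm, h']
  exact ModuleCat.isZero_of_subsingleton _

end Bifunctor

/-! ### The second cross-effect and the fold map. -/

section Cross

variable {k : Type} [CommRing k] {J : Type} [SmallCategory J]

/-- The second cross-effect of `B(-, Y)` at `(X, X')`. -/
def crossSubmodule (B : Gr × Gr ⥤ ModuleCat.{0} k) (X X' Y : Gr) :
    Submodule k (B.obj (add X X', Y)) :=
  LinearMap.ker (bimap B (pr₁ X X') (𝟙 Y)) ⊓ LinearMap.ker (bimap B (pr₂ X X') (𝟙 Y))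

theorem bimap_mem_crossSubmodule {B : Gr × Gr ⥤ ModuleCat.{0} k} {X X' Y Z Z' W : Gr}
    (f : X ⟶ Z) (f' : X' ⟶ Z') (g : Y ⟶ W) (x : B.obj (add X X', Y))
    (hx : x ∈ crossSubmodule B X X' Y) : bimap B (addMap f f') g x ∈ crossSubmodule B Z Z' W := by
  obtain ⟨h₁, h₂⟩ := hx
  constructor
  · change bimap B _ _ (bimap B _ _ x) = 0
    rw [bimap_bimap, addMap_pr₁, Category.comp_id, ← Category.id_comp g, ← bimap_bimap]
    exact (congrArg _ h₁).trans (map_zero _)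
  · change bimap B _ _ (bimap B _ _ x) = 0
    rw [bimap_bimap, addMap_pr₂, Category.comp_id, ← Category.id_comp g, ← bimap_bimap]
    exact (congrArg _ h₂).trans (map_zero _)

/-- The second cross-effect of `B` in the first variable, with arguments depending on `J`. -/
noncomputable def cross (B : Gr × Gr ⥤ ModuleCat.{0} k) (U V W : J ⥤ Gr) : J ⥤ ModuleCat.{0} k where
  obj j := ModuleCat.of k (crossSubmodule B (U.obj j) (V.obj j) (W.obj j))
  map f := ModuleCat.ofHom ((bimap B (addMap (U.map f) (V.map f)) (W.map f)).restrict
    (bimap_mem_crossSubmodule _ _ _))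
  map_id j := by
    refine ModuleCat.hom_ext (LinearMap.ext fun x => Subtype.ext ?_)
    change bimap B _ _ x.1 = x.1
    rw [U.map_id, V.map_id, W.map_id, addMap_id, bimap_id]
  map_comp f g := by
    refine ModuleCat.hom_ext (LinearMap.ext fun x => Subtype.ext ?_)
    change bimap B _ _ x.1 = bimap B _ _ (bimap B _ _ x.1)
    rw [U.map_comp, V.map_comp, W.map_comp, addMap_comp, bimap_bimap]

variable (B : Gr × Gr ⥤ ModuleCat.{0} k)

/-- The bifunctor `(X, Y) ↦ cr₂(B(-, Y))(X, X)`. -/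
noncomputable def crossDiag : Gr × Gr ⥤ ModuleCat.{0} k :=
  cross B (CategoryTheory.Prod.fst Gr Gr) (CategoryTheory.Prod.fst Gr Gr)
    (CategoryTheory.Prod.snd Gr Gr)

/-- The bifunctor `(X, Y) ↦ cr₂(B(-, Y))(X, Y)`. -/
noncomputable def crossMixed : Gr × Gr ⥤ ModuleCat.{0} k :=
  cross B (CategoryTheory.Prod.fst Gr Gr) (CategoryTheory.Prod.snd Gr Gr)
    (CategoryTheory.Prod.snd Gr Gr)

/-- The fold map `cr₂(B(-, Y))(X, X) ⟶ B(X, Y)`. -/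
noncomputable def crossFold : crossDiag B ⟶ B where
  app p := ModuleCat.ofHom
    ((bimap B (desc (𝟙 p.1) (𝟙 p.1)) (𝟙 p.2)).comp (crossSubmodule B p.1 p.1 p.2).subtype)
  naturality p q f := by
    refine ModuleCat.hom_ext (LinearMap.ext fun x => ?_)
    change bimap B (desc (𝟙 q.1) (𝟙 q.1)) (𝟙 q.2) (bimap B (addMap f.1 f.1) f.2 x.1) =
      bimap B f.1 f.2 (bimap B (desc (𝟙 p.1) (𝟙 p.1)) (𝟙 p.2) x.1)
    rw [bimap_bimap, bimap_bimap, Category.comp_id, Category.id_comp]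
    congr 2
    exact add_hom_ext (by simp) (by simp)

variable {B}

theorem coe_bimap_crossDiag {X X' Y Y' : Gr} (f : X ⟶ X') (g : Y ⟶ Y')
    (x : (crossDiag B).obj (X, Y)) :
    (bimap (crossDiag B) f g x : crossSubmodule B X' X' Y').1 =
      bimap B (addMap f f) g (x : crossSubmodule B X X Y).1 := rfl

theorem coe_bimap_crossMixed {X X' Y Y' : Gr} (f : X ⟶ X') (g : Y ⟶ Y')
    (x : (crossMixed B).obj (X, Y)) :
    (bimap (crossMixed B) f g x : crossSubmodule B X' Y' Y').1 =
      bimap B (addMap f g) g (x : crossSubmodule B X Y Y).1 := rfl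

theorem ReducedLeft.crossDiag (h : ReducedLeft B) : ReducedLeft (crossDiag B) :=
  fun X X' Y x => Subtype.ext <| by
    have h0 : addMap (0 : X ⟶ X') (0 : X ⟶ X') = 0 := add_hom_ext (by simp) (by simp)
    rw [coe_bimap_crossDiag, h0, h]
    rfl

/-- Killing the first argument factors through the second projection, which vanishes on the
cross-effect; `B` itself need not be reduced. -/
theorem reducedLeft_crossMixed : ReducedLeft (crossMixed B) :=
  fun X X' Y x => Subtype.ext <| by
    have h0 : addMap (0 : X ⟶ X') (𝟙 Y) = pr₂ X Y ≫ inr X' Y :=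
      add_hom_ext (by simp) (by simp)
    rw [coe_bimap_crossMixed, h0, ← Category.id_comp (𝟙 Y), ← bimap_bimap]
    exact (congrArg _ (x : crossSubmodule B X Y Y).2.2).trans (map_zero _)

/-- Colour both copies of `X` in the same way. -/
theorem DegreeLeftLE.crossDiag {d : ℕ} (h : DegreeLeftLE B d) : DegreeLeftLE (crossDiag B) d :=
  fun X Y χ x hx => Subtype.ext <| h (add X X) Y (Fin.addCases χ χ) _ fun i => by
    rw [kill_addCases, ← coe_bimap_crossDiag, hx]
    rfl

/-- The spare colour is spent on the whole second argument: killing it factors through the first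
projection, hence is zero on the cross-effect. The remaining colours are those of the first
argument. -/
theorem DegreeLeftLE.crossMixed {d : ℕ} (h : DegreeLeftLE B (d + 1)) :
    DegreeLeftLE (crossMixed B) d :=
  fun X Y χ x hx => Subtype.ext <|
    h (add X Y) Y (Fin.addCases (fun a => (χ a).castSucc) fun _ => Fin.last _) _ fun i => by
      rw [kill_addCases]
      induction i using Fin.lastCases with
      | last =>
        rw [kill_eq_id _ _ fun a => (Fin.castSucc_lt_last _).ne, kill_eq_zero _ _ fun _ => rfl,
          show addMap (𝟙 X) (0 : Y ⟶ Y) = pr₁ X Y ≫ inl X Y from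
            add_hom_ext (by simp) (by simp), ← Category.id_comp (𝟙 Y), ← bimap_bimap]
        exact (congrArg _ (x : crossSubmodule B X Y Y).2.1).trans (map_zero _)
      | cast i =>
        have h1 : kill (fun a => (χ a).castSucc) i.castSucc = kill χ i :=
          hom_ext fun a => by simp only [hom_kill, Fin.castSucc_inj]
        rw [h1, kill_eq_id _ _ fun a => (Fin.castSucc_lt_last _).ne', ← coe_bimap_crossMixed, hx]
        rfl

end Cross

open Gr

/-! ### The external product of `F` and `G`. -/

section External

variable {k : Type} [CommRing k]

/-- The external tensor product `(X, Y) ↦ F(X) ⊗ G(Y)`. -/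
noncomputable def externalProduct (F G : Gr ⥤ ModuleCat.{0} k) : Gr × Gr ⥤ ModuleCat.{0} k :=
  (CategoryTheory.Prod.fst Gr Gr ⋙ F) ⊗ (CategoryTheory.Prod.snd Gr Gr ⋙ G)

theorem bimap_externalProduct (F G : Gr ⥤ ModuleCat.{0} k) {X X' Y : Gr} (f : X ⟶ X') :
    bimap (externalProduct F G) f (𝟙 Y) = (F.map f).hom.rTensor (G.obj Y) := by
  change TensorProduct.map (F.map f).hom (G.map (𝟙 Y)).hom = _
  rw [G.map_id]
  rfl

theorem reducedLeft_externalProduct {F : Gr ⥤ ModuleCat.{0} k} (hF : IsReduced F)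
    (G : Gr ⥤ ModuleCat.{0} k) : ReducedLeft (externalProduct F G) := fun X X' Y x => by
  rw [bimap_externalProduct, hF.map_zero, ModuleCat.hom_zero, LinearMap.rTensor_zero]
  rfl

theorem degreeLeftLE_externalProduct {F : Gr ⥤ ModuleCat.{0} k} {d : ℕ}
    (hF : IsPolynomialOfDegreeLE F d) (G : Gr ⥤ ModuleCat.{0} k) :
    DegreeLeftLE (externalProduct F G) d := fun X Y χ x hx => by
  have hmul (f g : X ⟶ X) : (F.map f).hom * (F.map g).hom = (F.map (g ≫ f)).hom := by
    rw [F.map_comp]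
    rfl
  refine eq_zero_of_rTensor_eq_zero (V := F.obj X) (M := G.obj Y)
    (fun i => (F.map (kill χ i)).hom) (fun i j => ?_) (fun i => ?_)
    (fun v hv => hF.eq_zero_of_kill χ v hv) x fun i => ?_
  · rw [hmul, hmul, kill_comp_kill]
  · rw [hmul, kill_comp_self]
  · have h := hx i
    rw [bimap_externalProduct] at h
    exact h

end External

/-! ### Additive bifunctors and the functor `𝔞`. -/

section Additive

variable {k : Type} [CommRing k]

/-- A bifunctor is additive in the first variable. -/
def AdditiveLeft (Q : Gr × Gr ⥤ ModuleCat.{0} k) : Prop :=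
  ∀ (X X' Y : Gr) (x : Q.obj (add X X', Y)),
    x = bimap Q (pr₁ X X' ≫ inl X X') (𝟙 Y) x + bimap Q (pr₂ X X' ≫ inr X X') (𝟙 Y) x

/-- The cokernel of the fold map from the second cross-effect is additive. -/
theorem additiveLeft_of_exact {B Q : Gr × Gr ⥤ ModuleCat.{0} k} (hB : ReducedLeft B)
    (π : B ⟶ Q) (hπ : ∀ p, Function.Surjective (π.app p).hom) (h : crossFold B ≫ π = 0) :
    AdditiveLeft Q := fun X X' Y y => by
  obtain ⟨x, rfl⟩ := hπ _ y
  let z : B.obj (add X X', Y) := x - bimap B (pr₁ X X' ≫ inl X X') (𝟙 Y) x -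
    bimap B (pr₂ X X' ≫ inr X X') (𝟙 Y) x
  have hz : z ∈ crossSubmodule B X X' Y := by
    constructor
    · change bimap B _ _ z = 0
      simp only [z, map_sub, bimap_bimap, Category.assoc, inl_pr₁, inr_pr₁, Category.comp_id,
        comp_zero]
      rw [hB, sub_zero, sub_self]
    · change bimap B _ _ z = 0
      simp only [z, map_sub, bimap_bimap, Category.assoc, inl_pr₂, inr_pr₂, Category.comp_id,
        comp_zero]
      rw [hB, sub_zero, sub_self]
  -- Sending the two factors into two copies of their free product and then folding is the identity,
  -- so `z` is in the image of the fold map and dies in `Q`.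
  have hw := bimap_mem_crossSubmodule (inl X X') (inr X X') (𝟙 Y) z hz
  have hfold : (((crossFold B).app (add X X', Y)).hom
      (⟨_, hw⟩ : crossSubmodule B (add X X') (add X X') Y)) = z := by
    change bimap B _ _ (bimap B _ _ z) = z
    rw [bimap_bimap, show addMap (inl X X') (inr X X') ≫ desc (𝟙 _) (𝟙 _) = 𝟙 _ from
      add_hom_ext (by simp) (by simp), Category.comp_id, bimap_id]
  have h0 : (π.app _).hom z = 0 := by
    rw [← hfold]
    exact congrArg (fun t => (t.app (add X X', Y)).hom
      (⟨_, hw⟩ : crossSubmodule B (add X X') (add X X') Y)) h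
  rw [← bimap_naturality, ← bimap_naturality, ← sub_eq_zero, ← h0]
  simp only [z, map_sub]
  abel

namespace Gr

/-- The morphism `ℤ ⟶ X` which represents an element of `X`. -/
def point {X : Gr} (g : X.toGroup) : mk 1 ⟶ X :=
  ofHom (X := mk 1) (FreeGroup.lift fun _ => g)

/-- The morphism `X ⟶ ℤ` which sends the `j`-th generator to the generator and kills the
others. -/
def coord {X : Gr} (j : Fin X.rank) : X ⟶ mk 1 :=
  ofHom (Y := mk 1) (FreeGroup.lift fun a => if a = j then FreeGroup.of 0 else 1)

theorem hom_point {X : Gr} (g : X.toGroup) (a : Fin 1) :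
    hom (point g) (FreeGroup.of (α := Fin (mk 1).rank) a) = g :=
  FreeGroup.lift_apply_of

theorem hom_coord {X : Gr} (j a : Fin X.rank) :
    hom (coord j) (FreeGroup.of a) = if a = j then FreeGroup.of (α := Fin 1) 0 else 1 :=
  FreeGroup.lift_apply_of

theorem point_comp {X Y : Gr} (g : X.toGroup) (f : X ⟶ Y) : point g ≫ f = point (hom f g) :=
  hom_ext fun a => by
    rw [hom_comp]
    exact (congrArg (hom f) (hom_point g a)).trans (hom_point (hom f g) a).symm

theorem point_one (X : Gr) : point (1 : X.toGroup) = 0 :=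
  hom_ext fun a => hom_point _ a

theorem point_of_comp_coord {X : Gr} (i j : Fin X.rank) :
    point (FreeGroup.of i) ≫ coord j = if i = j then 𝟙 (mk 1) else 0 := by
  rw [point_comp, hom_coord]
  split_ifs
  · exact hom_ext fun a => (hom_point _ a).trans (congrArg FreeGroup.of (Subsingleton.elim _ _))
  · exact point_one _

theorem point_of_zero : point (FreeGroup.of (0 : Fin 1)) = 𝟙 (mk 1) :=
  hom_ext fun a => (hom_point _ a).trans
    (congrArg FreeGroup.of (Subsingleton.elim (α := Fin 1) _ _))

/-- The comultiplication of `ℤ`, which represents the product of two elements. -/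
def pinch : mk 1 ⟶ add (mk 1) (mk 1) :=
  point (hom (inl (mk 1) (mk 1)) (FreeGroup.of 0) * hom (inr (mk 1) (mk 1)) (FreeGroup.of 0))

theorem pinch_comp {X : Gr} (f : add (mk 1) (mk 1) ⟶ X) :
    pinch ≫ f = point (hom (inl _ _ ≫ f) (FreeGroup.of 0) *
      hom (inr _ _ ≫ f) (FreeGroup.of 0)) := by
  rw [pinch, point_comp, map_mul]
  rfl

theorem pinch_desc {X : Gr} (g h : X.toGroup) :
    pinch ≫ desc (point g) (point h) = point (g * h) := by
  rw [pinch_comp, inl_desc, inr_desc]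
  exact congrArg point (congrArg₂ _ (hom_point g 0) (hom_point h 0))

theorem pinch_pr₁ : pinch ≫ pr₁ (mk 1) (mk 1) = 𝟙 (mk 1) := by
  rw [pinch_comp, inl_pr₁, inr_pr₁, hom_zero, mul_one, hom_id, ← point_of_zero]

theorem pinch_pr₂ : pinch ≫ pr₂ (mk 1) (mk 1) = 𝟙 (mk 1) := by
  rw [pinch_comp, inl_pr₂, inr_pr₂, hom_zero, one_mul, hom_id, ← point_of_zero]

theorem coord_castSucc {n : ℕ} (j : Fin n) :
    (coord (X := mk (n + 1)) j.castSucc : add (mk n) (mk 1) ⟶ mk 1) =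
      pr₁ (mk n) (mk 1) ≫ coord (X := mk n) j := by
  refine add_hom_ext ?_ ?_
  · rw [inl_pr₁_assoc]
    refine hom_ext fun a => ?_
    rw [hom_comp, hom_inl, hom_coord, hom_coord]
    exact if_congr Fin.castSucc_inj rfl rfl
  · rw [inr_pr₁_assoc]
    refine hom_ext fun a => ?_
    rw [hom_comp, hom_inr, hom_coord]
    exact if_neg fun h => by
      have := congrArg Fin.val h
      simp only [Fin.val_natAdd, Fin.val_castSucc] at this
      omega

theorem coord_last (n : ℕ) :
    (coord (X := mk (n + 1)) (Fin.last n) : add (mk n) (mk 1) ⟶ mk 1) = pr₂ (mk n) (mk 1) := by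
  refine add_hom_ext ?_ ?_
  · rw [inl_pr₂]
    refine hom_ext fun a => ?_
    rw [hom_comp, hom_inl, hom_coord]
    exact if_neg (Fin.castSucc_lt_last a).ne
  · rw [inr_pr₂]
    refine hom_ext fun (a : Fin 1) => ?_
    obtain rfl := Subsingleton.elim a 0
    rw [hom_comp, hom_inr, hom_coord]
    exact if_pos rfl

theorem point_castSucc {n : ℕ} (j : Fin n) :
    (point (X := mk (n + 1)) (FreeGroup.of j.castSucc) : mk 1 ⟶ add (mk n) (mk 1)) =
      point (X := mk n) (FreeGroup.of j) ≫ inl (mk n) (mk 1) := by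
  rw [point_comp, hom_inl]
  rfl

theorem point_last (n : ℕ) :
    (point (X := mk (n + 1)) (FreeGroup.of (Fin.last n)) : mk 1 ⟶ add (mk n) (mk 1)) =
      inr (mk n) (mk 1) := by
  rw [← Category.id_comp (inr (mk n) (mk 1)), ← point_of_zero, point_comp]
  exact congrArg (point (X := mk (n + 1))) (hom_inr (X := mk n) (Y := mk 1) 0).symm

end Gr

variable {Q : Gr × Gr ⥤ ModuleCat.{0} k}

/-- A product of elements factors through `pinch`, and additivity splits the value at `ℤ * ℤ`. Thus
`g ↦ Q(point g)` is a homomorphism to an abelian group and factors through the abelianization. -/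
theorem AdditiveLeft.bimap_point_mul (hQ : AdditiveLeft Q) {X Y : Gr} (g h : X.toGroup)
    (x : Q.obj (mk 1, Y)) : bimap Q (point (g * h)) (𝟙 Y) x =
      bimap Q (point g) (𝟙 Y) x + bimap Q (point h) (𝟙 Y) x := by
  have e := congrArg (bimap Q (desc (point g) (point h)) (𝟙 Y))
    (hQ (mk 1) (mk 1) Y (bimap Q pinch (𝟙 Y) x))
  simpa only [map_add, bimap_bimap, Category.id_comp, ← pinch_desc, Category.assoc, inl_desc,
    inr_desc, reassoc_of% pinch_pr₁, reassoc_of% pinch_pr₂] using e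

/-- For `u` in the image of a zero morphism, both components of `u` equal `u`, so additivity reads
`u = u + u`. -/
theorem AdditiveLeft.reducedLeft (hQ : AdditiveLeft Q) : ReducedLeft Q := fun X X' Y x => by
  have e := hQ X' X' Y (bimap Q (0 : X ⟶ add X' X') (𝟙 Y) x)
  simp only [bimap_bimap, zero_comp, Category.id_comp] at e
  have h : (0 : X ⟶ X') = (0 : X ⟶ add X' X') ≫ pr₁ X' X' := zero_comp.symm
  rw [h, ← Category.id_comp (𝟙 Y), ← bimap_bimap, left_eq_add.1 e, map_zero]

/-- The value of an additive functor on a free group is the sum of those on the factors. -/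
theorem AdditiveLeft.sum_bimap (hQ : AdditiveLeft Q) {X Y : Gr} (x : Q.obj (X, Y)) :
    ∑ j, bimap Q (coord j ≫ point (FreeGroup.of j)) (𝟙 Y) x = x := by
  obtain ⟨n⟩ := X
  induction n with
  | zero =>
    rw [Fintype.sum_empty, ← bimap_id Q x, isZero_mk_zero.eq_of_src (𝟙 (mk 0)) 0,
      hQ.reducedLeft]
  | succ n ih =>
    have e := hQ (mk n) (mk 1) Y x
    refine (Fin.sum_univ_castSucc _).trans (Eq.trans (congrArg₂ _ ?_ ?_) e.symm)
    · have h := congrArg (bimap Q (inl (mk n) (mk 1)) (𝟙 Y)) (ih (bimap Q (pr₁ _ _) (𝟙 Y) x))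
      rw [map_sum, bimap_bimap, Category.comp_id] at h
      rw [← h]
      refine Finset.sum_congr rfl fun j _ => ?_
      rw [bimap_bimap, bimap_bimap, coord_castSucc, point_castSucc]
      simp only [Category.assoc, Category.comp_id]
    · rw [coord_last, point_last]

section Iso

/-- The generator of `𝔞(X)` attached to a generator of `X`. -/
noncomputable def abGen (k : Type) [CommRing k] {X : Gr} (g : X.toGroup) :
    (abelianization k).obj X :=
  (1 : k) ⊗ₜ[ℤ] Additive.ofMul (Abelianization.of g)

/-- Linear maps out of `𝔞(X) ⊗ M` agree if they do on generators. -/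
theorem abelianization_tensor_hom_ext {X : Gr} {M W : Type} [AddCommGroup M] [AddCommGroup W]
    [Module k M] [Module k W] {f g : (abelianization k).obj X ⊗[k] M →ₗ[k] W}
    (h : ∀ j m, f (abGen k (FreeGroup.of j) ⊗ₜ m) = g (abGen k (FreeGroup.of j) ⊗ₜ m)) : f = g := by
  refine TensorProduct.ext (Module.Basis.ext (Algebra.TensorProduct.basis k
    (FreeAbelianGroup.basis (Fin X.rank))) fun j => LinearMap.ext fun m => ?_)
  have hj : FreeAbelianGroup.basis (Fin X.rank) j = FreeAbelianGroup.of j :=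
    (FreeAbelianGroup.equivFinsupp (Fin X.rank)).injective
      (((FreeAbelianGroup.equivFinsupp (Fin X.rank)).apply_symm_apply _).trans
        (FreeAbelianGroup.toFinsupp_of j).symm)
  rw [Algebra.TensorProduct.basis_apply, hj]
  exact h j m

/-- The linear map `𝔞(X) → Hom(Q(ℤ, Y), Q(X, Y))`. -/
noncomputable def AdditiveLeft.action (hQ : AdditiveLeft Q) (X Y : Gr) :
    (abelianization k).obj X →ₗ[k] Q.obj (mk 1, Y) →ₗ[k] Q.obj (X, Y) :=
  LinearMap.liftBaseChange k (AddMonoidHom.toIntLinearMap (MonoidHom.toAdditiveLeft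
    (Abelianization.lift
      { toFun g := Multiplicative.ofAdd (bimap Q (point g) (𝟙 Y))
        map_one' := by
          rw [point_one]
          exact LinearMap.ext fun x => hQ.reducedLeft _ _ _ x
        map_mul' g h := LinearMap.ext fun x => hQ.bimap_point_mul g h x })))

theorem AdditiveLeft.action_abGen (hQ : AdditiveLeft Q) {X Y : Gr} (g : X.toGroup)
    (m : Q.obj (mk 1, Y)) : hQ.action X Y (abGen k g) m = bimap Q (point g) (𝟙 Y) m := by
  refine (LinearMap.congr_fun (LinearMap.liftBaseChange_tmul _ _ _ _) m).trans ?_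
  rw [one_smul]
  rfl

/-- An additive functor `Q` satisfies `Q(X, Y) ≅ 𝔞(X) ⊗ Q(ℤ, Y)`. -/
noncomputable def AdditiveLeft.equiv (hQ : AdditiveLeft Q) (X Y : Gr) :
    ((abelianization k).obj X ⊗[k] Q.obj (mk 1, Y)) ≃ₗ[k] Q.obj (X, Y) :=
  LinearEquiv.ofLinearMap (TensorProduct.lift (hQ.action X Y))
    -- The inverse takes coordinates: each generator is tensored with the image of `x` under the
    -- corresponding projection to `ℤ`.
    (∑ j, (TensorProduct.mk k _ _ (abGen k (FreeGroup.of j))) ∘ₗ bimap Q (coord j) (𝟙 Y))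
    (LinearMap.ext fun x => by
      simp only [LinearMap.comp_apply, LinearMap.sum_apply, map_sum, TensorProduct.mk_apply,
        TensorProduct.lift.tmul, hQ.action_abGen, bimap_bimap, Category.id_comp, hQ.sum_bimap,
        LinearMap.id_apply])
    (abelianization_tensor_hom_ext fun i m => by
      simp only [LinearMap.comp_apply, LinearMap.sum_apply, TensorProduct.mk_apply,
        TensorProduct.lift.tmul, hQ.action_abGen, bimap_bimap, Category.id_comp,
        LinearMap.id_apply, point_of_comp_coord]
      rw [Finset.sum_eq_single i (fun j _ hj => by
        rw [if_neg hj.symm, hQ.reducedLeft, TensorProduct.tmul_zero]) (by simp), if_pos rfl,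
        bimap_id])

/-- The diagonal of an additive functor is a tensor product with the abelianization. -/
noncomputable def AdditiveLeft.diagIso (hQ : AdditiveLeft Q) :
    abelianization k ⊗ (CategoryTheory.Prod.sectR (mk 1) Gr ⋙ Q) ≅ Functor.diag Gr ⋙ Q :=
  NatIso.ofComponents (fun X => (hQ.equiv X X).toModuleIso) fun {X X'} f => by
    refine ModuleCat.hom_ext (abelianization_tensor_hom_ext
      fun j (m : Q.obj (mk 1, X)) => ?_)
    change hQ.action X' X' (abGen k (hom f (FreeGroup.of j))) (bimap Q (𝟙 (mk 1)) f m) =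
      bimap Q f f (hQ.action X X (abGen k (FreeGroup.of j)) m)
    rw [hQ.action_abGen, hQ.action_abGen, bimap_bimap, bimap_bimap, point_comp]
    simp only [Category.id_comp, Category.comp_id]

end Iso

end Additive

/-! ### The double induction and the conclusion. -/

open Abelian

variable {k : Type} [CommRing k]

/-- Restriction to the diagonal preserves the vanishing criterion along a morphism. -/
theorem subsingleton_ext_diag {B D : Gr × Gr ⥤ ModuleCat.{0} k} (θ : D ⟶ B)
    {N : Gr ⥤ ModuleCat.{0} k} {n : ℕ}
    (hK : ∀ m < n, Subsingleton (Ext.{0} (Functor.diag Gr ⋙ kernel θ) N m))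
    (hD : Subsingleton (Ext.{0} (Functor.diag Gr ⋙ D) N n))
    (hQ : Subsingleton (Ext.{0} (Functor.diag Gr ⋙ cokernel θ) N n)) :
    Subsingleton (Ext.{0} (Functor.diag Gr ⋙ B) N n) :=
  let Δ := (Functor.whiskeringLeft Gr (Gr × Gr) (ModuleCat.{0} k)).obj (Functor.diag Gr)
  subsingleton_ext_of_kernel_cokernel (Δ.map θ)
    (fun m hm => subsingleton_ext_of_iso (PreservesKernel.iso Δ θ) (hK m hm)) hD
    (subsingleton_ext_of_iso (PreservesCokernel.iso Δ θ) hQ)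

/-- Bifunctors which are reduced and polynomial in the first variable are acyclic on the
diagonal if all the functors `𝔞 ⊗ G` are acyclic. -/
theorem subsingleton_ext_diag_of_degreeLeftLE {N : Gr ⥤ ModuleCat.{0} k}
    (hN : ∀ (G : Gr ⥤ ModuleCat.{0} k) (i : ℕ), Subsingleton (Ext.{0} (abelianization k ⊗ G) N i))
    (d i : ℕ) (B : Gr × Gr ⥤ ModuleCat.{0} k) (hd : DegreeLeftLE B d) (hr : ReducedLeft B) :
    Subsingleton (Ext.{0} (Functor.diag Gr ⋙ B) N i) := by
  induction d generalizing i B with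
  | zero =>
    refine subsingleton_ext_of_isZero ?_ i
    rw [Functor.isZero_iff]
    exact fun X => (Functor.isZero_iff _).1 (hd.isZero hr) (X, X)
  | succ d ihd =>
    -- The kernel of the fold map still has degree at most `d + 1`, so it is handled by an inner
    -- induction on the `Ext` degree.
    induction i using Nat.strong_induction_on generalizing B with
    | _ i ihi =>
    have hinj (X Y : Gr) :
        Function.Injective ((kernel.ι (crossFold B)).app (X, Y)).hom :=
      (ModuleCat.mono_iff_injective _).1 inferInstance
    have hsurj (p : Gr × Gr) : Function.Surjective ((cokernel.π (crossFold B)).app p).hom :=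
      (ModuleCat.epi_iff_surjective _).1 inferInstance
    have hQ : AdditiveLeft (cokernel (crossFold B)) :=
      additiveLeft_of_exact hr _ hsurj (cokernel.condition _)
    exact subsingleton_ext_diag (crossFold B)
      (fun m hm => ihi m hm _ (hd.crossDiag.of_injective _ hinj) (hr.crossDiag.of_injective _ hinj))
      -- `crossMixed B` and `crossDiag B` coincide after restriction to the diagonal, so the outer
      -- hypothesis applies to the source of the fold map.
      (ihd i (crossMixed B) hd.crossMixed reducedLeft_crossMixed)
      (subsingleton_ext_of_iso hQ.diagIso (hN _ i))

end FunctorHomology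

theorem mainTheorem6 (k : Type) [CommRing k] (hk : FunctorHomology.IsIntegersOrPrimeField k)
    (X : FunctorHomology.Grᵒᵖ ⥤ ModuleCat.{0} k)
    (hX : ∀ n i : ℕ, IsZero ((FunctorHomology.functorTor X i).obj
      (FunctorHomology.abelianization k ⊗ FunctorHomology.P k n)))
    (F G : FunctorHomology.Gr ⥤ ModuleCat.{0} k)
    (hF : FunctorHomology.IsPolynomial F) (hF0 : FunctorHomology.IsReduced F) (i : ℕ) :
    IsZero ((FunctorHomology.functorTor X i).obj (F ⊗ G)) := by
  obtain ⟨d, hd⟩ := hF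
  refine (FunctorHomology.isZero_leftDerived_obj_iff
    (FunctorHomology.tensorOverAdjunction X) _ i).2 fun I _ => ?_
  -- `F ⊗ G` is by definition the diagonal of the external product.
  refine FunctorHomology.subsingleton_ext_diag_of_degreeLeftLE
    (FunctorHomology.subsingleton_ext_tensor _ _ fun n i => ?_) d i
    (FunctorHomology.externalProduct F G) (FunctorHomology.degreeLeftLE_externalProduct hd G)
    (FunctorHomology.reducedLeft_externalProduct hF0 G)
  exact (FunctorHomology.isZero_leftDerived_obj_iff
    (FunctorHomology.tensorOverAdjunction X) _ i).1 (hX n i) I
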